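/- Let $J\ge 1$ and let $\gamma_1,\dots,\gamma_J$ be strictly increasing real functions on $(0,1)$ such that $\lim_{r\downarrow 0}\gamma_j(r)=0$ for every $j$ and $\lim_{r\downarrow 0}\gamma_j(r)/\gamma_i(r)=0$ for all $1\le i<j\le J$ (in particular, $\gamma_j>0$ on $(0,1)$). Let $W_0=\{W_0(t);\,t\ge 0\}$ be a one-dimensional standard Brownian motion. Then, as $r\downarrow 0$, the processes $$W_0^{(r)}=\Big\{\big(\gamma_1(r)\,W_0(t/\gamma_1^2(r)),\ \dots,\ \gamma_J(r)\,W_0(t/\gamma_J^2(r))\big);\ t\ge 0\Big\}$$ converge weakly, as random elements of $C([0,\infty),\mathbb{R}^J)$ with the topology of uniform convergence on compact time intervals, to a $J$-dimensional standard Brownian motion, that is, to a process $W_0^*=(W_{0,1}^*,\dots,W_{0,J}^*)$ whose coordinates are independent one-dimensional standard Brownian motions. -/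

import Mathlib

open MeasureTheory ProbabilityTheory Filter Set Topology
open scoped NNReal

/-- The path space `C([0,∞), E)` carries the topology of uniform convergence on compact sets
(the compact-open topology, which is Mathlib's instance); we equip it with its Borel σ-algebra. -/
instance pathMeasurableSpace {E : Type*} [TopologicalSpace E] : MeasurableSpace C(ℝ≥0, E) :=
  borel C(ℝ≥0, E)

instance pathBorelSpace {E : Type*} [TopologicalSpace E] : BorelSpace C(ℝ≥0, E) := ⟨rfl⟩

open Classical in
/-- The random element of `C([0,∞), E)` given by the paths of a process `X`. It is meant for
processes with almost surely continuous paths; the discontinuous paths (a null event) are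
replaced by the zero path. -/
noncomputable def continuousPath {Ω E : Type*} [TopologicalSpace E] [Zero E]
    (X : ℝ≥0 → Ω → E) (ω : Ω) : C(ℝ≥0, E) :=
  if h : Continuous (fun t => X t ω) then ⟨fun t => X t ω, h⟩ else 0

/-- `W` is a `J`-dimensional standard Brownian motion under `P`: its coordinate processes are
independent one-dimensional standard Brownian motions. -/
structure IsStandardBrownianMotion {J : ℕ} {Ω : Type*} [MeasurableSpace Ω]
    (W : ℝ≥0 → Ω → Fin J → ℝ) (P : Measure Ω) : Prop where
  coord : ∀ j, IsBrownianReal (fun t ω => W t ω j) P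
  indep : iIndepFun (fun (j : Fin J) (ω : Ω) (t : ℝ≥0) => W t ω j) P

/-- The standing conditions on the scale functions `γ₁, …, γ_J`: they are strictly increasing on
`(0,1)`, tend to `0` as `r ↓ 0`, and `γ_j(r) / γ_i(r) → 0` as `r ↓ 0` for `i < j`
(in particular they are positive on `(0,1)`). -/
structure IsSeparatedScales {J : ℕ} (γ : Fin J → ℝ → ℝ) : Prop where
  strictMonoOn : ∀ j, StrictMonoOn (γ j) (Ioo 0 1)
  tendsto_zero : ∀ j, Tendsto (γ j) (𝓝[>] 0) (𝓝 0)
  tendsto_ratio : ∀ i j, i < j → Tendsto (fun r => γ j r / γ i r) (𝓝[>] 0) (𝓝 0)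

/-- The process `t ↦ (γ₁(r) W₀(t / γ₁(r)²), …, γ_J(r) W₀(t / γ_J(r)²))`. -/
noncomputable def scaledProcess {J : ℕ} {Ω : Type*} (γ : Fin J → ℝ → ℝ) (W₀ : ℝ≥0 → Ω → ℝ)
    (r : ℝ) : ℝ≥0 → Ω → Fin J → ℝ :=
  fun t ω j => γ j r * W₀ ((t : ℝ) / γ j r ^ 2).toNNReal ω

/-! By Brownian scaling, each coordinate of the rescaled process is itself a Brownian motion
whenever its scale is nonzero, so its law does not depend on `r`. Tightness is therefore immediate:
a single law on the Polish path space is tight, and coordinatewise tightness gives tightness of the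
vector. All coordinates are linear in one Brownian motion, so the vector is jointly Gaussian and
centered, and only covariances matter. For `i < j` the covariance of coordinates `i` and `j` at
times `s` and `t` is `γ_i γ_j min(s/γ_i², t/γ_j²)`, which lies between `0` and `s γ_j/γ_i → 0`.
Separation of scales thus gives asymptotic independence, and the Gaussian characteristic functionals
converge (`tendsto_scaledCovariance`). Tightness upgrades this to weak convergence
(`tendsto_of_tight_of_tendsto_charFunctional`). -/

instance polishSpace_path {E : Type*} [UniformSpace E] [CompleteSpace E] [T0Space E]
    [(uniformity E).IsCountablyGenerated] [SecondCountableTopology E] :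
    PolishSpace C(ℝ≥0, E) :=
  have : TopologicalSpace.IsCompletelyMetrizableSpace C(ℝ≥0, E) := inferInstance
  inferInstance

/-! ### Measurability on path space through countably many times -/

section PathSpace

variable {E : Type*} [TopologicalSpace E]

/-- Evaluation of a path along a dense sequence of times. -/
noncomputable def evalDenseSeq (f : C(ℝ≥0, E)) (n : ℕ) : E :=
  f (TopologicalSpace.denseSeq ℝ≥0 n)

lemma continuous_evalDenseSeq : Continuous (evalDenseSeq (E := E)) :=
  continuous_pi fun _ => continuous_eval_const _

lemma injective_evalDenseSeq [T2Space E] : Function.Injective (evalDenseSeq (E := E)) := by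
  intro f g h
  refine DFunLike.coe_injective
    ((TopologicalSpace.denseRange_denseSeq ℝ≥0).equalizer f.continuous g.continuous ?_)
  exact h

/-- A continuous injection of a Polish space is a Borel embedding (Lusin–Souslin). Hence
measurability into path space, and equality of laws there, can be tested on a dense sequence of
times. -/
lemma measurableEmbedding_evalDenseSeq [T2Space E] [SecondCountableTopology E]
    [PolishSpace C(ℝ≥0, E)] [MeasurableSpace E] [BorelSpace E] :
    MeasurableEmbedding (evalDenseSeq (E := E)) :=
  continuous_evalDenseSeq.measurableEmbedding injective_evalDenseSeq

variable {Ω : Type*} [Zero E] {X : ℝ≥0 → Ω → E}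

lemma continuousPath_apply {ω : Ω} (h : Continuous (X · ω)) (t : ℝ≥0) :
    continuousPath X ω t = X t ω := by
  simp [continuousPath, h]

lemma continuousPath_ae_eq [MeasurableSpace Ω] {P : Measure Ω}
    (hX : ∀ᵐ ω ∂P, Continuous (X · ω)) :
    ∀ᵐ ω ∂P, ∀ t, continuousPath X ω t = X t ω :=
  hX.mono fun _ h => continuousPath_apply h

lemma aemeasurable_continuousPath [T2Space E] [SecondCountableTopology E]
    [PolishSpace C(ℝ≥0, E)] [MeasurableSpace E] [BorelSpace E]
    [MeasurableSpace Ω] {P : Measure Ω} (hXm : ∀ t, AEMeasurable (X t) P)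
    (hX : ∀ᵐ ω ∂P, Continuous (X · ω)) : AEMeasurable (continuousPath X) P := by
  rw [← measurableEmbedding_evalDenseSeq.aemeasurable_comp_iff]
  have : AEMeasurable (fun ω n => X (TopologicalSpace.denseSeq ℝ≥0 n) ω) P :=
    aemeasurable_pi_lambda _ fun n => hXm _
  refine this.congr ?_
  filter_upwards [continuousPath_ae_eq hX] with ω hω
  ext n
  simp [evalDenseSeq, hω]

end PathSpace

/-! ### Uniqueness and transfer of the one-dimensional Brownian law -/

section OneDim

variable {Ω Ω' : Type*} [MeasurableSpace Ω] [MeasurableSpace Ω'] {P : Measure Ω} {P' : Measure Ω'}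
  {X : ℝ≥0 → Ω → ℝ} {Y : ℝ≥0 → Ω' → ℝ}

lemma ProbabilityTheory.IsBrownianReal.aemeasurable_continuousPath (hX : IsBrownianReal X P) :
    AEMeasurable (continuousPath X) P :=
  _root_.aemeasurable_continuousPath hX.aemeasurable hX.cont

lemma ProbabilityTheory.IsBrownianReal.isProjectiveLimit (hX : IsBrownianReal X P) :
    IsProjectiveLimit ((P.map (continuousPath X)).map (fun (f : C(ℝ≥0, ℝ)) (t : ℝ≥0) => f t))
      BrownianReal.projectiveFamily := by
  intro I
  have hm : Measurable (fun (f : C(ℝ≥0, ℝ)) (t : ℝ≥0) => f t) :=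
    measurable_pi_lambda _ fun t => (continuous_eval_const t).measurable
  have hI := Finset.measurable_restrict (X := fun _ : ℝ≥0 => ℝ) I
  rw [Measure.map_map hI hm,
    AEMeasurable.map_map_of_aemeasurable (hI.comp hm).aemeasurable hX.aemeasurable_continuousPath,
    ← (hX.hasLaw I).map_eq]
  refine Measure.map_congr ?_
  filter_upwards [continuousPath_ae_eq hX.cont] with ω hω
  ext t
  simp [hω]

/-- The law of Brownian motion on path space is unique. -/
lemma ProbabilityTheory.IsBrownianReal.map_continuousPath_eq [IsProbabilityMeasure P]
    [IsProbabilityMeasure P'] (hX : IsBrownianReal X P) (hY : IsBrownianReal Y P') :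
    P.map (continuousPath X) = P'.map (continuousPath Y) := by
  have h := hX.isProjectiveLimit.unique hY.isProjectiveLimit
  have hm : Measurable (fun (f : C(ℝ≥0, ℝ)) (t : ℝ≥0) => f t) :=
    measurable_pi_lambda _ fun t => (continuous_eval_const t).measurable
  have hr : Measurable (fun (f : ℝ≥0 → ℝ) (n : ℕ) => f (TopologicalSpace.denseSeq ℝ≥0 n)) := by
    fun_prop
  -- The continuous paths are not a measurable subset of the full product, so the identity of laws
  -- is first restricted to the dense times, where the embedding can be inverted.
  replace h := congrArg (Measure.map
    (fun (f : ℝ≥0 → ℝ) (n : ℕ) => f (TopologicalSpace.denseSeq ℝ≥0 n))) h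
  rw [Measure.map_map hr hm, Measure.map_map hr hm] at h
  change Measure.map evalDenseSeq _ = Measure.map evalDenseSeq _ at h
  rw [← measurableEmbedding_evalDenseSeq.comap_map (P.map (continuousPath X)), h,
    measurableEmbedding_evalDenseSeq.comap_map]

/-- Brownian motion precomposed with a measure preserving map is a Brownian motion. -/
lemma ProbabilityTheory.IsBrownianReal.comp_measurePreserving (hX : IsBrownianReal X P)
    {f : Ω' → Ω} (hf : MeasurePreserving f P' P) :
    IsBrownianReal (fun t ω => X t (f ω)) P' where
  hasLaw I := (hX.hasLaw I).comp hf.hasLaw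
  cont := hf.quasiMeasurePreserving.ae hX.cont

/-- A process of continuous paths is a Brownian motion under a law on path space as soon as
it is one under a measure inducing that law. -/
lemma ProbabilityTheory.IsBrownianReal.of_map {S : Type*} [MeasurableSpace S] {F : Ω → S}
    (hF : AEMeasurable F P) {Z : ℝ≥0 → S → ℝ} (hZ : ∀ t, Measurable (Z t))
    (hZc : ∀ s, Continuous (Z · s)) (h : IsBrownianReal X P)
    (hXZ : ∀ᵐ ω ∂P, ∀ t, Z t (F ω) = X t ω) :
    IsBrownianReal Z (P.map F) where
  hasLaw I := by
    have hm : Measurable fun s => I.restrict (Z · s) := measurable_pi_lambda _ fun t => hZ t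
    refine ⟨hm.aemeasurable, ?_⟩
    rw [AEMeasurable.map_map_of_aemeasurable hm.aemeasurable hF, ← (h.hasLaw I).map_eq]
    refine Measure.map_congr ?_
    filter_upwards [hXZ] with ω hω
    ext t
    simp [hω]
  cont := ae_of_all _ hZc

end OneDim

/-! ### Characteristic functionals of Gaussian processes -/

section Charfun

variable {T Ω : Type*} [MeasurableSpace Ω] {P : Measure Ω} {X : T → Ω → ℝ}

/-- The characteristic functional of a centered Gaussian process. -/
lemma ProbabilityTheory.IsGaussianProcess.integral_exp_linearCombination
    (hX : IsGaussianProcess X P) (h0 : ∀ t, P[X t] = 0) (w : T →₀ ℝ) :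
    ∫ ω, Complex.exp ((Finsupp.linearCombination ℝ (X · ω) w : ℝ) * Complex.I) ∂P =
      Complex.exp (-((∑ p ∈ w.support, ∑ q ∈ w.support,
        w p * w q * cov[X p, X q; P] : ℝ) : ℂ) / 2) := by
  have := hX.isProbabilityMeasure
  have hG : HasGaussianLaw (fun ω => ∑ p ∈ w.support, w p • X p ω) P :=
    (hX.smul w).hasGaussianLaw_fun_sum
  have hmean : P[fun ω => ∑ p ∈ w.support, w p • X p ω] = 0 := by
    change ∫ ω, ∑ p ∈ w.support, (w p • X p) ω ∂P = 0
    rw [integral_finsetSum _ fun p _ => ((hX.hasGaussianLaw_eval p).integrable.smul (w p))]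
    simp [integral_const_mul, h0]
  have hvar : Var[fun ω => ∑ p ∈ w.support, w p • X p ω; P] =
      ∑ p ∈ w.support, ∑ q ∈ w.support, w p * w q * cov[X p, X q; P] := by
    rw [← covariance_self hG.aemeasurable, covariance_fun_sum_fun_sum']
    · simp [covariance_const_mul_left, covariance_const_mul_right, mul_assoc,
        mul_left_comm]
    all_goals exact fun p _ => ((hX.hasGaussianLaw_eval p).memLp_two.const_smul (w p))
  -- Frequency `1` suffices, since the weights are already absorbed into the linear combination.
  have h1 := charFun_apply_real (μ := P.map (fun ω => ∑ p ∈ w.support, w p • X p ω)) 1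
  rw [integral_map hG.aemeasurable (by fun_prop), hG.map_eq_gaussianReal, charFun_gaussianReal,
    hmean, hvar] at h1
  have hnn : 0 ≤ ∑ p ∈ w.support, ∑ q ∈ w.support, w p * w q * cov[X p, X q; P] :=
    hvar ▸ variance_nonneg _ _
  simp only [Finsupp.linearCombination_apply, Finsupp.sum]
  rw [Real.coe_toNNReal _ hnn] at h1
  simp only [Complex.ofReal_one, one_mul, Complex.ofReal_zero, zero_mul, zero_sub, one_pow,
    mul_one] at h1
  rw [← h1, neg_div]

end Charfun

/-! ### Weak convergence from tightness and characteristic functionals -/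

section PathChar

variable {ι : Type*}

/-- The pairing of a path with a finite linear combination of its coordinate evaluations. -/
noncomputable def pathPairing (ι : Type*) : C(ℝ≥0, ι → ℝ) →ₗ[ℝ] (ι × ℝ≥0 →₀ ℝ) →ₗ[ℝ] ℝ where
  toFun f := Finsupp.linearCombination ℝ fun p => f p.2 p.1
  map_add' f g := by ext; simp
  map_smul' c f := by ext; simp

lemma pathPairing_apply (f : C(ℝ≥0, ι → ℝ)) (w : ι × ℝ≥0 →₀ ℝ) :
    pathPairing ι f w = Finsupp.linearCombination ℝ (fun p => f p.2 p.1) w := rfl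

/-- With the discrete topology on the weights, joint continuity reduces to continuity in the path
for each fixed `w`. -/
lemma continuous_pathPairing :
    letI : TopologicalSpace (ι × ℝ≥0 →₀ ℝ) := ⊥
    Continuous fun p : C(ℝ≥0, ι → ℝ) × (ι × ℝ≥0 →₀ ℝ) => pathPairing ι p.1 p.2 := by
  let : TopologicalSpace (ι × ℝ≥0 →₀ ℝ) := ⊥
  have : DiscreteTopology (ι × ℝ≥0 →₀ ℝ) := ⟨rfl⟩
  refine continuous_prod_of_discrete_right.2 fun w => ?_
  simp only [pathPairing_apply, Finsupp.linearCombination_apply, Finsupp.sum]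
  refine continuous_finsetSum _ fun p _ => ?_
  have : Continuous fun f : C(ℝ≥0, ι → ℝ) => f p.2 p.1 :=
    (continuous_apply p.1).comp (continuous_eval_const p.2)
  exact this.const_smul (w p)

lemma pathPairing_ne_zero {f : C(ℝ≥0, ι → ℝ)} (hf : f ≠ 0) : pathPairing ι f ≠ 0 := by
  contrapose! hf
  ext t j
  simpa [pathPairing_apply] using DFunLike.congr_fun hf (Finsupp.single (j, t) 1)

/-- A tight family of laws on path space converges weakly as soon as the characteristic
functionals converge. -/
lemma tendsto_of_tight_of_tendsto_charFunctional [Fintype ι] {κ : Type*} {l : Filter κ}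
    {μ : κ → ProbabilityMeasure C(ℝ≥0, ι → ℝ)} {μ₀ : ProbabilityMeasure C(ℝ≥0, ι → ℝ)}
    (ht : IsTightMeasureSet {(μ n : Measure C(ℝ≥0, ι → ℝ)) | n})
    (h : ∀ w, Tendsto (fun n => ∫ f, Complex.exp ((pathPairing ι f w : ℝ) * Complex.I) ∂(μ n)) l
      (𝓝 (∫ f, Complex.exp ((pathPairing ι f w : ℝ) * Complex.I) ∂μ₀))) :
    Tendsto μ l (𝓝 μ₀) := by
  let : TopologicalSpace (ι × ℝ≥0 →₀ ℝ) := ⊥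
  have hc : Continuous Real.probChar := Real.continuous_probChar
  -- Finite combinations of the characters `f ↦ exp(i⟨f, w⟩)` form an algebra separating paths;
  -- under tightness, testing against it suffices.
  refine ProbabilityMeasure.tendsto_of_tight_of_separatesPoints ℂ ht
    (A := BoundedContinuousFunction.charPoly hc continuous_pathPairing)
    (BoundedContinuousFunction.separatesPoints_charPoly hc Real.probChar_ne_one
      continuous_pathPairing fun _ => pathPairing_ne_zero) fun g hg => ?_
  obtain ⟨w, hw⟩ := (BoundedContinuousFunction.mem_charPoly _).1 hg
  have h_eq (ν : Measure C(ℝ≥0, ι → ℝ)) [IsProbabilityMeasure ν] : ∫ f, g f ∂ν =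
      w.coeff.sum fun a z => z * ∫ f, Complex.exp ((pathPairing ι f a : ℝ) * Complex.I) ∂ν := by
    simp_rw [hw, Finsupp.sum]
    rw [integral_finsetSum]
    · simp [integral_const_mul, Real.probChar_apply]
    · intro a _
      exact ((BoundedContinuousFunction.char hc continuous_pathPairing a).integrable ν).const_mul _
  simp_rw [h_eq]
  exact tendsto_finsetSum _ fun a _ => (h a).const_mul _

end PathChar

/-! ### Tightness from the coordinates -/

section Tight

variable {ι : Type*}

lemma continuous_continuousMap_pi :
    Continuous (ContinuousMap.pi : (ι → C(ℝ≥0, ℝ)) → C(ℝ≥0, ι → ℝ)) := by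
  refine ContinuousMap.continuous_of_continuous_uncurry _ ?_
  refine continuous_pi fun j => ?_
  change Continuous fun p : (ι → C(ℝ≥0, ℝ)) × ℝ≥0 => p.1 j p.2
  fun_prop

/-- The `j`-th coordinate of a path. -/
def coordPath (j : ι) (f : C(ℝ≥0, ι → ℝ)) : C(ℝ≥0, ℝ) :=
  ⟨fun t => f t j, by fun_prop⟩

@[simp] lemma coordPath_apply (j : ι) (f : C(ℝ≥0, ι → ℝ)) (t : ℝ≥0) : coordPath j f t = f t j := rfl

lemma continuous_coordPath (j : ι) : Continuous (coordPath (ι := ι) j) :=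
  ContinuousMap.continuous_postcomp ⟨fun x : ι → ℝ => x j, continuous_apply j⟩

/-- A set of laws of multidimensional paths is tight if its coordinate laws are. -/
lemma isTightMeasureSet_of_coordPath [Fintype ι] {S : Set (Measure C(ℝ≥0, ι → ℝ))}
    (h : ∀ j, IsTightMeasureSet (Measure.map (coordPath j) '' S)) : IsTightMeasureSet S := by
  simp_rw [isTightMeasureSet_iff_exists_isCompact_measure_compl_le] at h ⊢
  intro ε hε
  obtain ⟨δ, hδ, hδε⟩ : ∃ δ : ENNReal, 0 < δ ∧ (Fintype.card ι) * δ ≤ ε := by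
    -- An empty index type is covered too: then the quotient is `⊤` and the product is `0`.
    refine ⟨ε / (Fintype.card ι), ENNReal.div_pos hε.ne' (by simp), ENNReal.mul_div_le⟩
  choose K hK hKS using fun j => h j δ hδ
  refine ⟨ContinuousMap.pi '' Set.pi univ K,
    (isCompact_univ_pi hK).image continuous_continuousMap_pi, fun μ hμ => ?_⟩
  have hsub : (ContinuousMap.pi '' Set.pi univ K)ᶜ ⊆ ⋃ j, coordPath j ⁻¹' (K j)ᶜ := by
    intro f hf
    by_contra hcon
    simp only [mem_iUnion, mem_preimage, mem_compl_iff, not_exists, not_not] at hcon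
    exact hf ⟨fun j => coordPath j f, fun j _ => hcon j, rfl⟩
  calc μ (ContinuousMap.pi '' Set.pi univ K)ᶜ ≤ μ (⋃ j, coordPath j ⁻¹' (K j)ᶜ) :=
        measure_mono hsub
    _ ≤ ∑ j, μ (coordPath j ⁻¹' (K j)ᶜ) := measure_iUnion_fintype_le _ _
    _ ≤ ∑ _j : ι, δ := by
        refine Finset.sum_le_sum fun j _ => ?_
        rw [← Measure.map_apply (continuous_coordPath j).measurable
          (hK j).isClosed.measurableSet.compl]
        exact hKS j _ ⟨μ, hμ, rfl⟩
    _ ≤ ε := by simpa using hδε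

end Tight

/-! ### Characteristic functionals of path laws -/

section CharFunctional

variable {ι Ω : Type*} [MeasurableSpace Ω] {P : Measure Ω} {X : ℝ≥0 → Ω → ι → ℝ}

/-- The characteristic functional of the law of a process with Gaussian coordinates. -/
lemma integral_map_exp_pathPairing
    (hG : IsGaussianProcess (fun (p : ι × ℝ≥0) ω => X p.2 ω p.1) P)
    (h0 : ∀ t j, ∫ ω, X t ω j ∂P = 0) (hm : AEMeasurable (continuousPath X) P)
    (hc : ∀ᵐ ω ∂P, Continuous (X · ω)) (w : ι × ℝ≥0 →₀ ℝ) :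
    ∫ f, Complex.exp ((pathPairing ι f w : ℝ) * Complex.I) ∂(P.map (continuousPath X)) =
      Complex.exp (-((∑ p ∈ w.support, ∑ q ∈ w.support,
        w p * w q * cov[fun ω => X p.2 ω p.1, fun ω => X q.2 ω q.1; P] : ℝ) : ℂ) / 2) := by
  have hcont : Continuous fun f : C(ℝ≥0, ι → ℝ) => pathPairing ι f w := by
    let : TopologicalSpace (ι × ℝ≥0 →₀ ℝ) := ⊥
    exact continuous_pathPairing.comp (Continuous.prodMk_left w)
  rw [integral_map hm (by fun_prop), ← hG.integral_exp_linearCombination (fun p => h0 p.2 p.1) w]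
  refine integral_congr_ae ?_
  filter_upwards [continuousPath_ae_eq hc] with ω hω
  simp [pathPairing_apply, hω]

end CharFunctional

/-! ### Standard Brownian motion in several dimensions -/

section StandardBrownianMotion

variable {J : ℕ} {Ω : Type*} [MeasurableSpace Ω] {P : Measure Ω} {W : ℝ≥0 → Ω → Fin J → ℝ}

namespace IsStandardBrownianMotion

lemma aemeasurable (hW : IsStandardBrownianMotion W P) (t : ℝ≥0) : AEMeasurable (W t) P :=
  aemeasurable_pi_lambda _ fun j => (hW.coord j).aemeasurable t

lemma cont (hW : IsStandardBrownianMotion W P) : ∀ᵐ ω ∂P, Continuous (W · ω) := by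
  filter_upwards [ae_all_iff.2 fun j => (hW.coord j).cont] with ω hω
  exact continuous_pi hω

lemma aemeasurable_continuousPath (hW : IsStandardBrownianMotion W P) :
    AEMeasurable (continuousPath W) P :=
  _root_.aemeasurable_continuousPath hW.aemeasurable hW.cont

lemma isGaussianProcess (hW : IsStandardBrownianMotion W P) :
    IsGaussianProcess (fun (p : Fin J × ℝ≥0) ω => W p.2 ω p.1) P where
  hasGaussianLaw I := by
    classical
    -- The index set is enlarged to a rectangle, every coordinate at all times of `T`, where
    -- independence yields joint Gaussianity; `L` projects back linearly.
    let T := I.image Prod.snd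
    have h1 : ∀ j, HasGaussianLaw (fun ω => T.restrict fun t => W t ω j) P := fun j =>
      (IsPreBrownianReal.isGaussianProcess (hW.coord j).toIsPreBrownianReal).hasGaussianLaw T
    have h2 : iIndepFun (fun j ω => T.restrict fun t => W t ω j) P :=
      hW.indep.comp (fun _ f => T.restrict f) fun _ => Finset.measurable_restrict T
    have h3 := iIndepFun.hasGaussianLaw h1 h2
    let L : (Fin J → T → ℝ) →L[ℝ] (I → ℝ) :=
      { toFun x p := x p.1.1 ⟨p.1.2, Finset.mem_image_of_mem _ p.2⟩
        map_add' x y := rfl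
        map_smul' c x := rfl
        cont := by fun_prop }
    exact h3.map L

lemma covariance_eval (hW : IsStandardBrownianMotion W P) (p q : Fin J × ℝ≥0) :
    cov[fun ω => W p.2 ω p.1, fun ω => W q.2 ω q.1; P] =
      if p.1 = q.1 then ((min p.2 q.2 : ℝ≥0) : ℝ) else 0 := by
  split_ifs with h
  · rw [h]
    simpa using (hW.coord q.1).covariance_eval p.2 q.2
  · have hp := hW.isGaussianProcess.hasGaussianLaw_eval p
    have hq := hW.isGaussianProcess.hasGaussianLaw_eval q
    have : IsProbabilityMeasure P := hW.isGaussianProcess.isProbabilityMeasure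
    refine IndepFun.covariance_eq_zero ?_ hp.memLp_two hq.memLp_two
    exact (hW.indep.indepFun h).comp (measurable_pi_apply p.2) (measurable_pi_apply q.2)

/-- The canonical process is a standard Brownian motion under the law of one. -/
lemma map_continuousPath [IsProbabilityMeasure P] (hW : IsStandardBrownianMotion W P) :
    IsStandardBrownianMotion (fun t (w : C(ℝ≥0, Fin J → ℝ)) => w t)
      (P.map (continuousPath W)) where
  coord j := by
    refine IsBrownianReal.of_map hW.aemeasurable_continuousPath (fun t => ?_) (fun w => by fun_prop)
      (hW.coord j) ?_
    · exact ((continuous_eval_const t).comp (continuous_coordPath j)).measurable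
    · filter_upwards [continuousPath_ae_eq hW.cont] with ω hω t
      rw [hω]
  indep := by
    have hF := hW.aemeasurable_continuousPath
    have hm : ∀ j : Fin J, Measurable fun (w : C(ℝ≥0, Fin J → ℝ)) (t : ℝ≥0) => w t j := fun j =>
      measurable_pi_lambda _ fun t =>
        ((continuous_eval_const t).comp (continuous_coordPath j)).measurable
    have := Measure.isProbabilityMeasure_map hF
    have h : iIndepFun (fun j : Fin J =>
        (fun (w : C(ℝ≥0, Fin J → ℝ)) (t : ℝ≥0) => w t j) ∘ continuousPath W) P := by
      refine hW.indep.congr fun j => ?_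
      filter_upwards [continuousPath_ae_eq hW.cont] with ω hω
      ext t
      simp [hω]
    -- Written as "joint law equals product law", independence depends only on the law of the path
    -- and so passes to the pushforward.
    rw [iIndepFun_iff_map_fun_eq_pi_map fun j => (hm j).comp_aemeasurable hF] at h
    rw [iIndepFun_iff_map_fun_eq_pi_map fun j => (hm j).aemeasurable,
      AEMeasurable.map_map_of_aemeasurable (measurable_pi_lambda _ hm).aemeasurable hF]
    simp_rw [AEMeasurable.map_map_of_aemeasurable (hm _).aemeasurable hF]
    exact h

end IsStandardBrownianMotion

/-- Independent copies of a Brownian path form a standard Brownian motion. -/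
lemma ProbabilityTheory.IsBrownianReal.isStandardBrownianMotion_pi [IsProbabilityMeasure P]
    {B : ℝ≥0 → Ω → ℝ} (hB : IsBrownianReal B P) (J : ℕ) :
    IsStandardBrownianMotion (fun t (w : Fin J → C(ℝ≥0, ℝ)) j => w j t)
      (Measure.pi fun _ => P.map (continuousPath B)) := by
  have hF := hB.aemeasurable_continuousPath
  have := Measure.isProbabilityMeasure_map hF
  have hcan : IsBrownianReal (fun t (w : C(ℝ≥0, ℝ)) => w t) (P.map (continuousPath B)) := by
    refine IsBrownianReal.of_map hF (fun t => (continuous_eval_const t).measurable)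
      (fun w => w.continuous) hB ?_
    exact continuousPath_ae_eq hB.cont
  refine ⟨fun j => hcan.comp_measurePreserving (measurePreserving_eval _ j), ?_⟩
  exact iIndepFun_pi (X := fun (_ : Fin J) (w : C(ℝ≥0, ℝ)) (t : ℝ≥0) => w t) fun j =>
    (measurable_pi_lambda _ fun t => (continuous_eval_const t).measurable).aemeasurable

end StandardBrownianMotion

/-! ### The rescaled process and its limit -/

section Scaled

variable {J : ℕ} {γ : Fin J → ℝ → ℝ}

/-- By monotonicity, `γ_j(r) > γ_j(r/2) ≥ lim γ_j = 0`. -/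
lemma IsSeparatedScales.pos (hγ : IsSeparatedScales γ) (j : Fin J) {r : ℝ} (hr : r ∈ Ioo (0 : ℝ) 1) :
    0 < γ j r := by
  have hr2 : r / 2 ∈ Ioo (0 : ℝ) 1 := ⟨by linarith [hr.1], by linarith [hr.1, hr.2]⟩
  refine lt_of_le_of_lt ?_ (hγ.strictMonoOn j hr2 hr (by linarith [hr.1]))
  refine le_of_tendsto (hγ.tendsto_zero j) ?_
  filter_upwards [Ioo_mem_nhdsGT hr2.1] with s hs
  exact (hγ.strictMonoOn j ⟨hs.1, hs.2.trans hr2.2⟩ hr2 hs.2).le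

lemma IsSeparatedScales.eventually_pos (hγ : IsSeparatedScales γ) :
    ∀ᶠ r in 𝓝[>] (0 : ℝ), ∀ j, 0 < γ j r := by
  filter_upwards [Ioo_mem_nhdsGT one_pos] with r hr j using hγ.pos j hr

/-- The covariance of two coordinates of the scaled process. -/
noncomputable def scaledCovariance (γ : Fin J → ℝ → ℝ) (r : ℝ) (p q : Fin J × ℝ≥0) : ℝ :=
  γ p.1 r * γ q.1 r * min ((p.2 : ℝ) / γ p.1 r ^ 2) ((q.2 : ℝ) / γ q.1 r ^ 2)

lemma scaledCovariance_comm (r : ℝ) (p q : Fin J × ℝ≥0) :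
    scaledCovariance γ r p q = scaledCovariance γ r q p := by
  rw [scaledCovariance, scaledCovariance, min_comm, mul_comm (γ p.1 r)]

lemma scaledCovariance_of_fst_eq {r : ℝ} {p q : Fin J × ℝ≥0} (h : p.1 = q.1) (hr : γ q.1 r ≠ 0) :
    scaledCovariance γ r p q = (min p.2 q.2 : ℝ≥0) := by
  rw [scaledCovariance, h, min_div_div_right (sq_nonneg _), NNReal.coe_min]
  field_simp

/-- Bounding the minimum by the clock of the larger scale `γ_{p.1}` leaves a constant times the
vanishing ratio. -/
lemma IsSeparatedScales.tendsto_scaledCovariance_of_lt (hγ : IsSeparatedScales γ)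
    {p q : Fin J × ℝ≥0} (h : p.1 < q.1) :
    Tendsto (fun r => scaledCovariance γ r p q) (𝓝[>] 0) (𝓝 0) := by
  have hlim : Tendsto (fun r => (p.2 : ℝ) * (γ q.1 r / γ p.1 r)) (𝓝[>] 0) (𝓝 0) := by
    simpa using (hγ.tendsto_ratio _ _ h).const_mul (p.2 : ℝ)
  refine tendsto_of_tendsto_of_tendsto_of_le_of_le' tendsto_const_nhds hlim ?_ ?_
  · filter_upwards [hγ.eventually_pos] with r hr
    have := hr p.1
    have := hr q.1
    unfold scaledCovariance
    positivity
  · filter_upwards [hγ.eventually_pos] with r hr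
    have hp := hr p.1
    have hq := hr q.1
    calc scaledCovariance γ r p q ≤ γ p.1 r * γ q.1 r * ((p.2 : ℝ) / γ p.1 r ^ 2) := by
          unfold scaledCovariance
          gcongr
          exact min_le_left _ _
      _ = (p.2 : ℝ) * (γ q.1 r / γ p.1 r) := by field_simp

lemma IsSeparatedScales.tendsto_scaledCovariance (hγ : IsSeparatedScales γ)
    (p q : Fin J × ℝ≥0) :
    Tendsto (fun r => scaledCovariance γ r p q) (𝓝[>] 0)
      (𝓝 (if p.1 = q.1 then ((min p.2 q.2 : ℝ≥0) : ℝ) else 0)) := by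
  split_ifs with h
  · refine tendsto_const_nhds.congr' ?_
    filter_upwards [hγ.eventually_pos] with r hr
    exact (scaledCovariance_of_fst_eq h (hr _).ne').symm
  · rcases lt_or_gt_of_ne h with h | h
    · exact hγ.tendsto_scaledCovariance_of_lt h
    · simpa only [scaledCovariance_comm] using hγ.tendsto_scaledCovariance_of_lt h

variable {Ω : Type*} [MeasurableSpace Ω] {P : Measure Ω} {B : ℝ≥0 → Ω → ℝ}

lemma isGaussianProcess_scaledProcess (hB : IsBrownianReal B P) (γ : Fin J → ℝ → ℝ) (r : ℝ) :
    IsGaussianProcess (fun (p : Fin J × ℝ≥0) ω => scaledProcess γ B r p.2 ω p.1) P :=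
  (hB.isGaussianProcess.comp_right fun p : Fin J × ℝ≥0 =>
    ((p.2 : ℝ) / γ p.1 r ^ 2).toNNReal).smul fun p : Fin J × ℝ≥0 => γ p.1 r

lemma integral_scaledProcess (hB : IsBrownianReal B P) (γ : Fin J → ℝ → ℝ) (r : ℝ) (t : ℝ≥0)
    (j : Fin J) : ∫ ω, scaledProcess γ B r t ω j ∂P = 0 := by
  simp [scaledProcess, integral_const_mul, hB.integral_eval]

lemma covariance_scaledProcess (hB : IsBrownianReal B P) (γ : Fin J → ℝ → ℝ) (r : ℝ)
    (p q : Fin J × ℝ≥0) :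
    cov[fun ω => scaledProcess γ B r p.2 ω p.1, fun ω => scaledProcess γ B r q.2 ω q.1; P] =
      scaledCovariance γ r p q := by
  simp only [scaledProcess]
  rw [covariance_const_mul_left, covariance_const_mul_right, hB.covariance_fun_eval,
    scaledCovariance, NNReal.coe_min, Real.coe_toNNReal _ (by positivity),
    Real.coe_toNNReal _ (by positivity), mul_assoc]

lemma continuous_scaledProcess (hB : IsBrownianReal B P) (γ : Fin J → ℝ → ℝ) (r : ℝ) :
    ∀ᵐ ω ∂P, Continuous (scaledProcess γ B r · ω) := by
  filter_upwards [hB.cont] with ω hω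
  refine continuous_pi fun j => ?_
  unfold scaledProcess
  fun_prop

lemma aemeasurable_continuousPath_scaledProcess (hB : IsBrownianReal B P) (γ : Fin J → ℝ → ℝ)
    (r : ℝ) : AEMeasurable (continuousPath (scaledProcess γ B r)) P :=
  aemeasurable_continuousPath
    (fun t => aemeasurable_pi_lambda _ fun j =>
      (isGaussianProcess_scaledProcess hB γ r).aemeasurable (j, t))
    (continuous_scaledProcess hB γ r)

/-- Brownian scaling. -/
lemma isBrownianReal_scaledProcess (hB : IsBrownianReal B P) {r : ℝ} {j : Fin J}
    (hr : γ j r ≠ 0) : IsBrownianReal (fun t ω => scaledProcess γ B r t ω j) P where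
  toIsPreBrownianReal := by
    refine ((isGaussianProcess_scaledProcess hB γ r).comp_right
      fun t => (j, t)).isPreBrownianReal_of_covariance
      (fun t => integral_scaledProcess hB γ r t j) fun s t hst => ?_
    refine (covariance_scaledProcess hB γ r (j, s) (j, t)).trans ?_
    rw [scaledCovariance_of_fst_eq (p := (j, s)) (q := (j, t)) rfl hr]
    simp [hst]
  cont := by
    filter_upwards [continuous_scaledProcess hB γ r] with ω hω
    exact (continuous_apply j).comp hω

/-- Tightness is required over all real `r`, and off `(0,1)` a scale may vanish; the Dirac mass at
the zero path accounts for that case. -/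
lemma map_coordPath_scaledProcess [IsProbabilityMeasure P] (hB : IsBrownianReal B P)
    (γ : Fin J → ℝ → ℝ) (r : ℝ) (j : Fin J) :
    (P.map (continuousPath (scaledProcess γ B r))).map (coordPath j) ∈
      ({P.map (continuousPath B)} ∪ {Measure.dirac 0} : Set (Measure C(ℝ≥0, ℝ))) := by
  rw [AEMeasurable.map_map_of_aemeasurable (continuous_coordPath j).measurable.aemeasurable
    (aemeasurable_continuousPath_scaledProcess hB γ r)]
  by_cases hr : γ j r = 0
  · right
    rw [mem_singleton_iff, Measure.map_congr (g := fun _ => 0), Measure.map_const]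
    · simp
    · filter_upwards [continuousPath_ae_eq (continuous_scaledProcess hB γ r)] with ω hω
      ext t
      simp [hω, scaledProcess, hr]
  · left
    have hj := isBrownianReal_scaledProcess hB hr
    rw [mem_singleton_iff, ← hj.map_continuousPath_eq hB]
    refine Measure.map_congr ?_
    filter_upwards [continuousPath_ae_eq (continuous_scaledProcess hB γ r),
      continuousPath_ae_eq hj.cont] with ω h1 h2
    ext t
    simp [h1, h2]

theorem tendstoInDistribution_scaledProcess [IsProbabilityMeasure P] (hγ : IsSeparatedScales γ)
    (hB : IsBrownianReal B P) {Ω' : Type*} [MeasurableSpace Ω'] {P' : Measure Ω'}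
    [IsProbabilityMeasure P'] {W : ℝ≥0 → Ω' → Fin J → ℝ} (hW : IsStandardBrownianMotion W P') :
    TendstoInDistribution (fun r : ℝ => continuousPath (scaledProcess γ B r)) (𝓝[>] 0)
      (continuousPath W) (fun _ => P) P' where
  forall_aemeasurable r := aemeasurable_continuousPath_scaledProcess hB γ r
  aemeasurable_limit := hW.aemeasurable_continuousPath
  tendsto := by
    refine tendsto_of_tight_of_tendsto_charFunctional ?_ fun w => ?_
    · refine isTightMeasureSet_of_coordPath fun j => ?_
      have := Measure.isProbabilityMeasure_map hB.aemeasurable_continuousPath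
      refine (isTightMeasureSet_singleton.union isTightMeasureSet_singleton).subset ?_
        (T := {P.map (continuousPath B)} ∪ {Measure.dirac 0})
      rintro _ ⟨_, ⟨r, rfl⟩, rfl⟩
      exact map_coordPath_scaledProcess hB γ r j
    · simp only [ProbabilityMeasure.coe_mk]
      rw [integral_map_exp_pathPairing hW.isGaussianProcess
        (fun t j => (hW.coord j).integral_eval t) hW.aemeasurable_continuousPath hW.cont]
      simp_rw [integral_map_exp_pathPairing (isGaussianProcess_scaledProcess hB γ _)
        (integral_scaledProcess hB γ _) (aemeasurable_continuousPath_scaledProcess hB γ _)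
        (continuous_scaledProcess hB γ _), hW.covariance_eval, covariance_scaledProcess hB]
      -- Both functionals are one continuous function of finitely many covariances, so entrywise
      -- convergence is enough.
      refine (Complex.continuous_exp.tendsto _).comp (Tendsto.div_const (Tendsto.neg ?_) _)
      refine (Complex.continuous_ofReal.tendsto _).comp ?_
      exact tendsto_finsetSum _ fun p _ => tendsto_finsetSum _ fun q _ =>
        (hγ.tendsto_scaledCovariance p q).const_mul _

end Scaled

theorem proposition2 (J : ℕ) (γ : Fin J → ℝ → ℝ) (hγ : IsSeparatedScales γ)
    (Ω : Type*) [MeasurableSpace Ω] (P : Measure Ω) [IsProbabilityMeasure P]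
    (W₀ : ℝ≥0 → Ω → ℝ) (hW₀ : IsBrownianReal W₀ P) :
    (∃ ν : ProbabilityMeasure C(ℝ≥0, Fin J → ℝ),
      IsStandardBrownianMotion (fun t (w : C(ℝ≥0, Fin J → ℝ)) => w t)
        (ν : Measure C(ℝ≥0, Fin J → ℝ)) ∧
      TendstoInDistribution (fun r : ℝ => continuousPath (scaledProcess γ W₀ r)) (𝓝[>] 0)
        (id : C(ℝ≥0, Fin J → ℝ) → C(ℝ≥0, Fin J → ℝ)) (fun _ => P)
        (ν : Measure C(ℝ≥0, Fin J → ℝ))) ∧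
    ∀ (Ω' : Type*) [MeasurableSpace Ω'] (P' : Measure Ω') [IsProbabilityMeasure P']
      (W : ℝ≥0 → Ω' → Fin J → ℝ), IsStandardBrownianMotion W P' →
      TendstoInDistribution (fun r : ℝ => continuousPath (scaledProcess γ W₀ r)) (𝓝[>] 0)
        (continuousPath W) (fun _ => P) P' := by

  refine ⟨?_, fun Ω' _ P' _ W hW => tendstoInDistribution_scaledProcess hγ hW₀ hW⟩
  have := Measure.isProbabilityMeasure_map hW₀.aemeasurable_continuousPath
  -- The limit law `ν` comes from the product of `J` copies of the path law of `W₀`, pushed forward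
  -- to vector-valued paths.
  have hpi := hW₀.isStandardBrownianMotion_pi J
  have hν := hpi.map_continuousPath
  have hprob := Measure.isProbabilityMeasure_map hpi.aemeasurable_continuousPath
  refine ⟨⟨_, hprob⟩, hν, ?_⟩
  have hid : continuousPath (fun t (w : C(ℝ≥0, Fin J → ℝ)) => w t) = id := by
    ext w t
    rw [continuousPath_apply w.continuous, id]
  have h := tendstoInDistribution_scaledProcess hγ hW₀ hν
  rwa [hid] at h
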